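/- \textbf{Setting.} Let $X=(X_u)_{u\in[0,1]}$ be a Brownian bridge on $[0,1]$ from $x\in\mathbb R$ to $y\in\mathbb R$ (a Gaussian process with mean $(1-u)x+uy$, covariance $s\wedge u-su$, and almost surely continuous paths). For $0\le s<t\le 1$ put $m_{s,t}=\inf_{[s,t]}X$ and $M_{s,t}=\sup_{[s,t]}X$. An \emph{intersection layer} on $[s,t]$ is a collection $\mathcal I_{s,t}=\{X_s,X_t,\mathcal L_{s,t},\mathcal U_{s,t}\}$, where the intervals (layers) $\mathcal L_{s,t}=[L^\downarrow_{s,t},L^\uparrow_{s,t}]$ and $\mathcal U_{s,t}=[U^\downarrow_{s,t},U^\uparrow_{s,t}]$ satisfy $m_{s,t}\in\mathcal L_{s,t}$ and $M_{s,t}\in\mathcal U_{s,t}$. \textbf{Bisection} of $\mathcal I_{s,t}$, with layers $[L^\downarrow,L^\uparrow]$ and $[U^\downarrow,U^\uparrow]$: set $t^*=(s+t)/2$, reveal $X_{t^*}$, and replace $U^\downarrow$ by $U^\downarrow\vee X_{t^*}$ and $L^\uparrow$ by $L^\uparrow\wedge X_{t^*}$. For each half $[a,b]\in\{[s,t^*],[t^*,t]\}$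 put $\mathcal U_{a,b}=[U^\downarrow,U^\uparrow]$ if $M_{a,b}\ge U^\downarrow$ and $\mathcal U_{a,b}=[X_a\vee X_b,U^\downarrow]$ otherwise; put $\mathcal L_{a,b}=[L^\downarrow,L^\uparrow]$ if $m_{a,b}\le L^\uparrow$ and $\mathcal L_{a,b}=[L^\uparrow,X_a\wedge X_b]$ otherwise. \textbf{Refinement} of a layer replaces it by its lower or upper closed half, whichever contains the corresponding extremum (if the extremum is the midpoint, the upper half for a maximum and the lower half for a minimum). \textbf{The $\varepsilon$-strong algorithm} starts from $\mathcal I_{0,1}=\{X_0,X_1,\mathcal L_{0,1},\mathcal U_{0,1}\}$, where $\mathcal L_{0,1}$ and $\mathcal U_{0,1}$ are any (possibly random) intervals with $m_{0,1}\in\mathcal L_{0,1}$ and $M_{0,1}\in\mathcal U_{0,1}$ almost surely. In each iteration every current intersection layer $\mathcal I_{s,t}$ is bisected, and each layer of $\mathcal I_{s,t^*}$ and $\mathcal I_{t^*,t}$ is then refined repeatedly until its width is not greater than $\sqrt{(t-s)/2}$. After $n$ iterations this yields intersection layers on the intervals $[(i-1)2^{-n},i2^{-n}]$, $1\le i\le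 2^n$, and one sets, for $u\in[0,1]$, $$X^\uparrow_u(n)=\sum_{i=1}^{2^n}U^\uparrow_{(i-1)2^{-n},i2^{-n}}\,\mathbf 1_{\{u\in((i-1)2^{-n},i2^{-n}]\}},\qquad X^\downarrow_u(n)=\sum_{i=1}^{2^n}L^\downarrow_{(i-1)2^{-n},i2^{-n}}\,\mathbf 1_{\{u\in((i-1)2^{-n},i2^{-n}]\}}.$$ \textbf{Proposition.} With probability $1$, $$\lim_{n\to\infty}\ \sup_{u\in[0,1]}\bigl|X^\uparrow_u(n)-X^\downarrow_u(n)\bigr|=0 .$$ -/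

import Mathlib

open Set Filter Topology MeasureTheory ProbabilityTheory

noncomputable section

namespace EpsStrong

/-- `X` (read only at times in `[0,1]`) is a Brownian bridge on `[0,1]` from `x` to `y` under `P`:
a Gaussian process on `[0,1]` with mean `(1 - t) x + t y` and covariance `min s t - s t` whose
paths are almost surely continuous on `[0,1]`. -/
structure IsBrownianBridge {Ω : Type*} [MeasurableSpace Ω] (X : ℝ → Ω → ℝ) (x y : ℝ)
    (P : Measure Ω) : Prop where
  gaussian : IsGaussianProcess (fun (t : Icc (0 : ℝ) 1) (ω : Ω) => X t ω) P
  mean : ∀ t ∈ Icc (0 : ℝ) 1, ∫ ω, X t ω ∂P = (1 - t) * x + t * y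
  cov : ∀ s ∈ Icc (0 : ℝ) 1, ∀ t ∈ Icc (0 : ℝ) 1, cov[X s, X t; P] = min s t - s * t
  continuousOn : ∀ᵐ ω ∂P, ContinuousOn (fun t => X t ω) (Icc (0 : ℝ) 1)

/-- The maximum of the path `f` on `[s,t]`. -/
def pathMax (f : ℝ → ℝ) (s t : ℝ) : ℝ := sSup (f '' Icc s t)

/-- The minimum of the path `f` on `[s,t]`. -/
def pathMin (f : ℝ → ℝ) (s t : ℝ) : ℝ := sInf (f '' Icc s t)

/-- A layer: an interval `[lo, hi]` which is to contain an extremum of the path. -/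
@[ext]
structure Layer where
  lo : ℝ
  hi : ℝ

namespace Layer

/-- The interval described by a layer. -/
def toSet (ℓ : Layer) : Set ℝ := Icc ℓ.lo ℓ.hi

/-- The width of a layer. -/
def width (ℓ : Layer) : ℝ := ℓ.hi - ℓ.lo

/-- The midpoint of a layer. -/
def mid (ℓ : Layer) : ℝ := (ℓ.lo + ℓ.hi) / 2

/-- One refinement of the layer of a maximum `M`: keep the half that contains `M`. -/
def refineMax (M : ℝ) (ℓ : Layer) : Layer :=
  if ℓ.mid ≤ M then ⟨ℓ.mid, ℓ.hi⟩ else ⟨ℓ.lo, ℓ.mid⟩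

/-- One refinement of the layer of a minimum `m`: keep the half that contains `m`. -/
def refineMin (m : ℝ) (ℓ : Layer) : Layer :=
  if m ≤ ℓ.mid then ⟨ℓ.lo, ℓ.mid⟩ else ⟨ℓ.mid, ℓ.hi⟩

/-- Repeat `step` until the width of the layer is not greater than `tol`: the number of
repetitions is the first `k` after which the width is at most `tol`. -/
def refineUntil (step : Layer → Layer) (tol : ℝ) (ℓ : Layer) : Layer :=
  step^[sInf {k : ℕ | (step^[k] ℓ).width ≤ tol}] ℓ

theorem width_refineMax (M : ℝ) (ℓ : Layer) : (refineMax M ℓ).width = ℓ.width / 2 := by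
  unfold refineMax width mid
  split_ifs <;> ring

theorem width_refineMin (m : ℝ) (ℓ : Layer) : (refineMin m ℓ).width = ℓ.width / 2 := by
  unfold refineMin width mid
  split_ifs <;> ring

/-- The refinement loop stops when each step halves the width and the tolerance is positive. -/
theorem width_refineUntil_le {step : Layer → Layer} (h : ∀ ℓ, (step ℓ).width = ℓ.width / 2)
    {tol : ℝ} (htol : 0 < tol) (ℓ : Layer) : (refineUntil step tol ℓ).width ≤ tol := by
  have hk : ∀ k : ℕ, (step^[k] ℓ).width = ℓ.width * (1 / 2) ^ k := by
    intro k
    induction k with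
    | zero => simp
    | succ k ih => rw [Function.iterate_succ_apply', h, ih, pow_succ]; ring
  have hlim : Tendsto (fun k : ℕ => ℓ.width * (1 / 2 : ℝ) ^ k) atTop (𝓝 (ℓ.width * 0)) :=
    (tendsto_pow_atTop_nhds_zero_of_lt_one (by norm_num) (by norm_num)).const_mul _
  rw [mul_zero] at hlim
  obtain ⟨k, hk'⟩ := (hlim.eventually (gt_mem_nhds htol)).exists
  have hne : {k : ℕ | (step^[k] ℓ).width ≤ tol}.Nonempty := ⟨k, by
    simp only [mem_ofPred_eq, hk]
    exact hk'.le⟩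
  exact Nat.sInf_mem hne

end Layer

/-- The intersection layer of a path on an interval `[s,t]`: the values of the path at the two
end points, a layer for the minimum and a layer for the maximum. -/
structure IntersectionLayer where
  left : ℝ
  right : ℝ
  low : Layer
  up : Layer

/-- Bisection of the intersection layer `I` of the path `f` on `[s,t]` at `t* = (s + t) / 2`.
First the value of the path at `t*` is revealed, and the inner ends of the two layers are moved
to `U↓ ∨ X_{t*}` and `L↑ ∧ X_{t*}`. Then, for each half of `[s,t]`, it is decided whether its
maximum (minimum) is still in the outer range `[U↓, U↑]` (`[L↓, L↑]`) or is in the inner one. -/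
def bisect (f : ℝ → ℝ) (s t : ℝ) (I : IntersectionLayer) :
    IntersectionLayer × IntersectionLayer :=
  let c := (s + t) / 2
  let w := f c
  let uDown := max I.up.lo w
  let lUp := min I.low.hi w
  (⟨I.left, w,
      if pathMin f s c ≤ lUp then ⟨I.low.lo, lUp⟩ else ⟨lUp, min I.left w⟩,
      if uDown ≤ pathMax f s c then ⟨uDown, I.up.hi⟩ else ⟨max I.left w, uDown⟩⟩,
   ⟨w, I.right,
      if pathMin f c t ≤ lUp then ⟨I.low.lo, lUp⟩ else ⟨lUp, min w I.right⟩,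
      if uDown ≤ pathMax f c t then ⟨uDown, I.up.hi⟩ else ⟨max w I.right, uDown⟩⟩)

/-- Refinement of the intersection layer `I` of the path `f` on `[s,t]`, until the widths of
both layers are not greater than `tol`. -/
def refine (f : ℝ → ℝ) (s t tol : ℝ) (I : IntersectionLayer) : IntersectionLayer :=
  { I with
    low := Layer.refineUntil (Layer.refineMin (pathMin f s t)) tol I.low
    up := Layer.refineUntil (Layer.refineMax (pathMax f s t)) tol I.up }

/-- The dyadic point `j 2^{-n}`. -/
def dyadic (n j : ℕ) : ℝ := (j : ℝ) / 2 ^ n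

/-- The `ε`-strong algorithm for the path `f` on `[0,1]`, started from the layers `L` and `U` for
the minimum and the maximum of `f` on `[0,1]`. `epsStrong f L U n j`, for `j < 2 ^ n`, is the
intersection layer on `[j 2^{-n}, (j + 1) 2^{-n}]` after `n` iterations. In an iteration each
current interval `[s,t]` is bisected and its two halves are refined until the widths of their
layers are not greater than `√((t - s) / 2)`. -/
def epsStrong (f : ℝ → ℝ) (L U : Layer) : ℕ → ℕ → IntersectionLayer
  | 0, _ => ⟨f 0, f 1, L, U⟩
  | n + 1, j =>
    let i := j / 2
    let s := dyadic n i
    let t := dyadic n (i + 1)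
    let c := (s + t) / 2
    let B := bisect f s t (epsStrong f L U n i)
    if j % 2 = 0 then refine f s c (√((t - s) / 2)) B.1
    else refine f c t (√((t - s) / 2)) B.2

/-- The upper dominating process `X↑(n)` at time `u`. -/
def upperDominating (f : ℝ → ℝ) (L U : Layer) (n : ℕ) (u : ℝ) : ℝ :=
  ∑ j ∈ Finset.range (2 ^ n),
    (Ioc (dyadic n j) (dyadic n (j + 1))).indicator (fun _ => (epsStrong f L U n j).up.hi) u

/-- The lower dominating process `X↓(n)` at time `u`. -/
def lowerDominating (f : ℝ → ℝ) (L U : Layer) (n : ℕ) (u : ℝ) : ℝ :=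
  ∑ j ∈ Finset.range (2 ^ n),
    (Ioc (dyadic n j) (dyadic n (j + 1))).indicator (fun _ => (epsStrong f L U n j).low.lo) u

end EpsStrong

end

/-! The argument is pathwise and deterministic, for a continuous path `f`. On a dyadic interval of
length `2^{-n}`, the gap between the outer ends of the two layers is at most (maximum − minimum of
`f`) plus the two layer widths, provided that the layers really contain the extrema. This
containment is an invariant of bisection and refinement (`isIntersectionLayer_epsStrong`). The
widths are at most `2^{-n/2}` by the stopping rule (`width_epsStrong_le`), and the oscillation tends
to `0` uniformly over the intervals by uniform continuity; `eventually_abs_epsStrong_sub_le` adds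
these bounds. The half-open dyadic intervals are disjoint, so a bound on each of them is a bound on
the supremum over `u`. -/

namespace EpsStrong

/-! ### Extrema of a continuous path on a compact interval -/

section PathExtrema

variable {f : ℝ → ℝ} {s t : ℝ}

theorem bddAbove_image_Icc (hf : ContinuousOn f (Icc s t)) : BddAbove (f '' Icc s t) :=
  (isCompact_Icc.image_of_continuousOn hf).bddAbove

theorem bddBelow_image_Icc (hf : ContinuousOn f (Icc s t)) : BddBelow (f '' Icc s t) :=
  (isCompact_Icc.image_of_continuousOn hf).bddBelow

theorem le_pathMax (hf : ContinuousOn f (Icc s t)) {u : ℝ} (hu : u ∈ Icc s t) :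
    f u ≤ pathMax f s t :=
  le_csSup (bddAbove_image_Icc hf) (mem_image_of_mem f hu)

theorem pathMin_le (hf : ContinuousOn f (Icc s t)) {u : ℝ} (hu : u ∈ Icc s t) :
    pathMin f s t ≤ f u :=
  csInf_le (bddBelow_image_Icc hf) (mem_image_of_mem f hu)

theorem pathMax_mono (hf : ContinuousOn f (Icc s t)) {a b : ℝ} (hab : a ≤ b)
    (h : Icc a b ⊆ Icc s t) : pathMax f a b ≤ pathMax f s t :=
  csSup_le_csSup (bddAbove_image_Icc hf) ((nonempty_Icc.2 hab).image f) (image_mono h)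

theorem pathMin_anti (hf : ContinuousOn f (Icc s t)) {a b : ℝ} (hab : a ≤ b)
    (h : Icc a b ⊆ Icc s t) : pathMin f s t ≤ pathMin f a b :=
  csInf_le_csInf (bddBelow_image_Icc hf) ((nonempty_Icc.2 hab).image f) (image_mono h)

theorem exists_eq_pathMax (hf : ContinuousOn f (Icc s t)) (hst : s ≤ t) :
    ∃ u ∈ Icc s t, pathMax f s t = f u :=
  isCompact_Icc.exists_sSup_image_eq (nonempty_Icc.2 hst) hf

theorem exists_eq_pathMin (hf : ContinuousOn f (Icc s t)) (hst : s ≤ t) :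
    ∃ u ∈ Icc s t, pathMin f s t = f u :=
  isCompact_Icc.exists_sInf_image_eq (nonempty_Icc.2 hst) hf

end PathExtrema

namespace Layer

theorem mem_refineMax {M : ℝ} {ℓ : Layer} (h : M ∈ ℓ.toSet) : M ∈ (refineMax M ℓ).toSet := by
  unfold refineMax
  split_ifs with hM
  · exact ⟨hM, h.2⟩
  · exact ⟨h.1, (not_le.1 hM).le⟩

theorem mem_refineMin {m : ℝ} {ℓ : Layer} (h : m ∈ ℓ.toSet) : m ∈ (refineMin m ℓ).toSet := by
  unfold refineMin
  split_ifs with hm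
  · exact ⟨h.1, hm⟩
  · exact ⟨(not_le.1 hm).le, h.2⟩

/-- Membership survives any number of steps, so the value of the stopping index is irrelevant here.
-/
theorem mem_refineUntil {step : Layer → Layer} {v : ℝ}
    (hstep : ∀ ℓ : Layer, v ∈ ℓ.toSet → v ∈ (step ℓ).toSet) (tol : ℝ) {ℓ : Layer}
    (h : v ∈ ℓ.toSet) : v ∈ (refineUntil step tol ℓ).toSet := by
  have key : ∀ k : ℕ, v ∈ (step^[k] ℓ).toSet := by
    intro k
    induction k with
    | zero => exact h
    | succ k ih => rw [Function.iterate_succ_apply']; exact hstep _ ih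
  exact key _

end Layer

/-- `I` is an intersection layer of the path `f` on `[s,t]`: it records the values of `f` at the
end points, and its layers contain the minimum and the maximum of `f`. -/
structure IsIntersectionLayer (f : ℝ → ℝ) (s t : ℝ) (I : IntersectionLayer) : Prop where
  left_eq : I.left = f s
  right_eq : I.right = f t
  min_mem : pathMin f s t ∈ I.low.toSet
  max_mem : pathMax f s t ∈ I.up.toSet

/-! ### Bisection and refinement preserve intersection layers -/

section Steps

variable {f : ℝ → ℝ} {s t : ℝ} {I : IntersectionLayer}

theorem IsIntersectionLayer.refine (h : IsIntersectionLayer f s t I) (tol : ℝ) :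
    IsIntersectionLayer f s t (refine f s t tol I) where
  left_eq := h.left_eq
  right_eq := h.right_eq
  min_mem := Layer.mem_refineUntil (fun _ => Layer.mem_refineMin) tol h.min_mem
  max_mem := Layer.mem_refineUntil (fun _ => Layer.mem_refineMax) tol h.max_mem

/-- The outer ends stay valid because the extrema over a half lie between those over the whole
interval. In the inner case the new bound is an end-point value, which is why the invariant also
records `left` and `right`. -/
theorem IsIntersectionLayer.bisect_fst (h : IsIntersectionLayer f s t I)
    (hf : ContinuousOn f (Icc s t)) (hst : s ≤ t) :
    IsIntersectionLayer f s ((s + t) / 2) (bisect f s t I).1 := by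
  have hsc : s ≤ (s + t) / 2 := by linarith
  have hsub : Icc s ((s + t) / 2) ⊆ Icc s t := Icc_subset_Icc_right (by linarith)
  have hf' := hf.mono hsub
  refine ⟨h.left_eq, rfl, ?_, ?_⟩
  · simp only [bisect]
    split_ifs with hm
    · exact ⟨h.min_mem.1.trans (pathMin_anti hf hsc hsub), hm⟩
    · refine ⟨(not_le.1 hm).le, le_min ?_ (pathMin_le hf' (right_mem_Icc.2 hsc))⟩
      rw [h.left_eq]
      exact pathMin_le hf' (left_mem_Icc.2 hsc)
  · simp only [bisect]
    split_ifs with hM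
    · exact ⟨hM, (pathMax_mono hf hsc hsub).trans h.max_mem.2⟩
    · refine ⟨max_le ?_ (le_pathMax hf' (right_mem_Icc.2 hsc)), (not_le.1 hM).le⟩
      rw [h.left_eq]
      exact le_pathMax hf' (left_mem_Icc.2 hsc)

theorem IsIntersectionLayer.bisect_snd (h : IsIntersectionLayer f s t I)
    (hf : ContinuousOn f (Icc s t)) (hst : s ≤ t) :
    IsIntersectionLayer f ((s + t) / 2) t (bisect f s t I).2 := by
  have hct : (s + t) / 2 ≤ t := by linarith
  have hsub : Icc ((s + t) / 2) t ⊆ Icc s t := Icc_subset_Icc_left (by linarith)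
  have hf' := hf.mono hsub
  refine ⟨rfl, h.right_eq, ?_, ?_⟩
  · simp only [bisect]
    split_ifs with hm
    · exact ⟨h.min_mem.1.trans (pathMin_anti hf hct hsub), hm⟩
    · refine ⟨(not_le.1 hm).le, le_min (pathMin_le hf' (left_mem_Icc.2 hct)) ?_⟩
      rw [h.right_eq]
      exact pathMin_le hf' (right_mem_Icc.2 hct)
  · simp only [bisect]
    split_ifs with hM
    · exact ⟨hM, (pathMax_mono hf hct hsub).trans h.max_mem.2⟩
    · refine ⟨max_le (le_pathMax hf' (left_mem_Icc.2 hct)) ?_, (not_le.1 hM).le⟩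
      rw [h.right_eq]
      exact le_pathMax hf' (right_mem_Icc.2 hct)

end Steps

/-! ### Arithmetic of dyadic points -/

section Dyadic

theorem dyadic_mono (n : ℕ) : Monotone (dyadic n) := fun i j h => by
  unfold dyadic
  gcongr

theorem dyadic_nonneg (n j : ℕ) : 0 ≤ dyadic n j := by
  unfold dyadic
  positivity

theorem dyadic_le_one {n j : ℕ} (h : j ≤ 2 ^ n) : dyadic n j ≤ 1 := by
  unfold dyadic
  rw [div_le_one (by positivity)]
  exact_mod_cast h

theorem dyadic_succ_sub (n j : ℕ) : dyadic n (j + 1) - dyadic n j = (1 / 2) ^ n := by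
  unfold dyadic
  rw [one_div_pow]
  push_cast
  ring

theorem dyadic_succ_two_mul (n i : ℕ) : dyadic (n + 1) (2 * i) = dyadic n i := by
  unfold dyadic
  rw [pow_succ]
  push_cast
  field_simp

theorem dyadic_add_div_two (n i : ℕ) :
    (dyadic n i + dyadic n (i + 1)) / 2 = dyadic (n + 1) (2 * i + 1) := by
  unfold dyadic
  rw [pow_succ]
  push_cast
  field_simp
  ring

theorem Icc_dyadic_subset {n j : ℕ} (h : j < 2 ^ n) :
    Icc (dyadic n j) (dyadic n (j + 1)) ⊆ Icc 0 1 :=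
  Icc_subset_Icc (dyadic_nonneg n j) (dyadic_le_one h)

end Dyadic

/-! ### The algorithm along a continuous path -/

section Algorithm

variable {f : ℝ → ℝ} {L U : Layer}

/-- Resolves the parity test and expresses the child interval and the tolerance at level `n + 1`. -/
theorem epsStrong_succ_two_mul (n i : ℕ) :
    epsStrong f L U (n + 1) (2 * i) =
      refine f (dyadic (n + 1) (2 * i)) (dyadic (n + 1) (2 * i + 1)) (√((1 / 2) ^ (n + 1)))
        (bisect f (dyadic n i) (dyadic n (i + 1)) (epsStrong f L U n i)).1 := by
  simp only [epsStrong, Nat.mul_mod_right, if_true, Nat.mul_div_cancel_left i two_pos,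
    dyadic_succ_sub, dyadic_add_div_two, dyadic_succ_two_mul]
  rw [pow_succ, mul_one_div]

theorem epsStrong_succ_two_mul_add_one (n i : ℕ) :
    epsStrong f L U (n + 1) (2 * i + 1) =
      refine f (dyadic (n + 1) (2 * i + 1)) (dyadic (n + 1) (2 * i + 2)) (√((1 / 2) ^ (n + 1)))
        (bisect f (dyadic n i) (dyadic n (i + 1)) (epsStrong f L U n i)).2 := by
  have h1 : (2 * i + 1) % 2 ≠ 0 := by omega
  have h2 : (2 * i + 1) / 2 = i := by omega
  simp only [epsStrong, if_neg h1, h2, dyadic_succ_sub, dyadic_add_div_two]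
  rw [show 2 * i + 2 = 2 * (i + 1) by ring, dyadic_succ_two_mul, pow_succ, mul_one_div]

/-- Only levels from `1` on are covered: the initial layers are never refined and may be arbitrarily
wide. -/
theorem width_epsStrong_le (n j : ℕ) :
    (epsStrong f L U (n + 1) j).low.width ≤ √((1 / 2) ^ (n + 1)) ∧
      (epsStrong f L U (n + 1) j).up.width ≤ √((1 / 2) ^ (n + 1)) := by
  have htol : 0 < √((1 / 2 : ℝ) ^ (n + 1)) := by positivity
  obtain ⟨i, rfl | rfl⟩ := j.even_or_odd'
  · rw [epsStrong_succ_two_mul]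
    exact ⟨Layer.width_refineUntil_le (Layer.width_refineMin _) htol _,
      Layer.width_refineUntil_le (Layer.width_refineMax _) htol _⟩
  · rw [epsStrong_succ_two_mul_add_one]
    exact ⟨Layer.width_refineUntil_le (Layer.width_refineMin _) htol _,
      Layer.width_refineUntil_le (Layer.width_refineMax _) htol _⟩

theorem isIntersectionLayer_epsStrong (hf : ContinuousOn f (Icc 0 1))
    (hL : pathMin f 0 1 ∈ L.toSet) (hU : pathMax f 0 1 ∈ U.toSet) (n : ℕ) :
    ∀ j < 2 ^ n, IsIntersectionLayer f (dyadic n j) (dyadic n (j + 1)) (epsStrong f L U n j) := by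
  induction n with
  | zero =>
    intro j hj
    obtain rfl : j = 0 := by simpa using hj
    have h0 : dyadic 0 0 = 0 := by simp [dyadic]
    have h1 : dyadic 0 (0 + 1) = 1 := by simp [dyadic]
    rw [h0, h1]
    exact ⟨rfl, rfl, hL, hU⟩
  | succ n ih =>
    intro j hj
    rw [pow_succ] at hj
    obtain ⟨i, rfl | rfl⟩ := j.even_or_odd'
    · have hi : i < 2 ^ n := by omega
      have h := (ih i hi).bisect_fst (hf.mono (Icc_dyadic_subset hi)) (dyadic_mono n i.le_succ)
      rw [dyadic_add_div_two, ← dyadic_succ_two_mul] at h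
      rw [epsStrong_succ_two_mul]
      convert h.refine _ using 2
      rw [dyadic_succ_two_mul]
    · have hi : i < 2 ^ n := by omega
      have h := (ih i hi).bisect_snd (hf.mono (Icc_dyadic_subset hi)) (dyadic_mono n i.le_succ)
      rw [epsStrong_succ_two_mul_add_one]
      rw [dyadic_add_div_two] at h
      have e : dyadic n (i + 1) = dyadic (n + 1) (2 * i + 1 + 1) := (dyadic_succ_two_mul n _).symm
      rw [e] at h ⊢
      exact h.refine _

/-- The layers are at most as far apart as the oscillation of the path and their widths. -/
theorem eventually_abs_epsStrong_sub_le (hf : ContinuousOn f (Icc 0 1))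
    (hL : pathMin f 0 1 ∈ L.toSet) (hU : pathMax f 0 1 ∈ U.toSet) {ε : ℝ} (hε : 0 < ε) :
    ∀ᶠ n : ℕ in atTop, ∀ j < 2 ^ n,
      |(epsStrong f L U n j).up.hi - (epsStrong f L U n j).low.lo| ≤ ε := by
  obtain ⟨δ, hδ, hosc⟩ := Metric.uniformContinuousOn_iff.1
    (isCompact_Icc.uniformContinuousOn_of_continuous hf) (ε / 2) (half_pos hε)
  have hpow : Tendsto (fun n : ℕ => (1 / 2 : ℝ) ^ n) atTop (𝓝 0) :=
    tendsto_pow_atTop_nhds_zero_of_lt_one (by norm_num) (by norm_num)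
  have hsqrt : Tendsto (fun n : ℕ => √((1 / 2 : ℝ) ^ n)) atTop (𝓝 0) := by
    simpa using hpow.sqrt
  -- Budget: `ε / 2` for the oscillation and `ε / 4` for each of the two widths.
  filter_upwards [hpow.eventually (gt_mem_nhds hδ),
    hsqrt.eventually (gt_mem_nhds (show 0 < ε / 4 by positivity)), eventually_ge_atTop 1]
    with n hnδ hnε hn j hj
  obtain ⟨n, rfl⟩ := Nat.exists_eq_succ_of_ne_zero (Nat.one_le_iff_ne_zero.1 hn)
  have hsub := Icc_dyadic_subset hj
  have hle := dyadic_mono (n + 1) j.le_succ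
  have hI := isIntersectionLayer_epsStrong hf hL hU (n + 1) j hj
  obtain ⟨hwL, hwU⟩ := width_epsStrong_le (f := f) (L := L) (U := U) n j
  obtain ⟨a, ha, hMa⟩ := exists_eq_pathMax (hf.mono hsub) hle
  obtain ⟨b, hb, hmb⟩ := exists_eq_pathMin (hf.mono hsub) hle
  have hba : f b ≤ f a := hmb ▸ pathMin_le (hf.mono hsub) ha
  have hab : dist (f a) (f b) < ε / 2 := by
    refine hosc a (hsub ha) b (hsub hb) ((Real.dist_le_of_mem_Icc ha hb).trans_lt ?_)
    rwa [dyadic_succ_sub]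
  rw [Real.dist_eq, abs_of_nonneg (sub_nonneg.2 hba)] at hab
  have hmin := hI.min_mem
  have hmax := hI.max_mem
  rw [hmb] at hmin
  rw [hMa] at hmax
  obtain ⟨hm1, hm2⟩ := hmin
  obtain ⟨hM1, hM2⟩ := hmax
  simp only [Layer.width] at hwL hwU
  simp only [Nat.succ_eq_add_one] at *
  -- The sign comes from `low.lo ≤ f b ≤ f a ≤ up.hi`.
  rw [abs_of_nonneg (by linarith)]
  linarith

theorem abs_sum_indicator_Ioc_dyadic_le {n : ℕ} {c : ℕ → ℝ} {ε : ℝ} (hε : 0 ≤ ε)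
    (hc : ∀ j < 2 ^ n, |c j| ≤ ε) (u : ℝ) :
    |∑ j ∈ Finset.range (2 ^ n),
      (Ioc (dyadic n j) (dyadic n (j + 1))).indicator (fun _ => c j) u| ≤ ε := by
  by_cases h : ∃ j ∈ Finset.range (2 ^ n), u ∈ Ioc (dyadic n j) (dyadic n (j + 1))
  · obtain ⟨j, hj, hu⟩ := h
    rw [Finset.sum_eq_single_of_mem j hj, indicator_of_mem hu]
    · exact hc j (Finset.mem_range.1 hj)
    · intro k _ hkj
      refine indicator_of_notMem (fun hk => ?_) _
      exact disjoint_left.1 ((dyadic_mono n).pairwise_disjoint_on_Ioc_succ hkj) hk hu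
  -- Within `[0,1]` this is the case `u = 0`, which lies in no half-open cell; both dominating
  -- processes vanish there.
  · push Not at h
    rw [Finset.sum_eq_zero fun j hj => indicator_of_notMem (h j hj) _, abs_zero]
    exact hε

theorem upperDominating_sub_lowerDominating (n : ℕ) (u : ℝ) :
    upperDominating f L U n u - lowerDominating f L U n u =
      ∑ j ∈ Finset.range (2 ^ n), (Ioc (dyadic n j) (dyadic n (j + 1))).indicator
        (fun _ => (epsStrong f L U n j).up.hi - (epsStrong f L U n j).low.lo) u := by
  simp only [upperDominating, lowerDominating, ← Finset.sum_sub_distrib]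
  exact Finset.sum_congr rfl fun j _ => (congrFun (indicator_sub _ _ _) u).symm

/-- The dominating processes of a continuous path converge uniformly to each other. -/
theorem tendsto_iSup_upperDominating_sub_lowerDominating (hf : ContinuousOn f (Icc 0 1))
    (hL : pathMin f 0 1 ∈ L.toSet) (hU : pathMax f 0 1 ∈ U.toSet) :
    Tendsto (fun n : ℕ => ⨆ u ∈ Icc (0 : ℝ) 1,
        ENNReal.ofReal |upperDominating f L U n u - lowerDominating f L U n u|)
      atTop (𝓝 0) := by
  rw [ENNReal.tendsto_nhds_zero]
  intro ε hε
  -- `ε` may be `∞`, whereas the estimate on the layers takes a real tolerance.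
  obtain ⟨r, hr, hrε⟩ := ENNReal.lt_iff_exists_nnreal_btwn.1 hε
  filter_upwards [eventually_abs_epsStrong_sub_le hf hL hU (NNReal.coe_pos.2
    (ENNReal.coe_pos.1 hr))] with n hn
  refine iSup₂_le fun u _ => le_trans ?_ hrε.le
  rw [upperDominating_sub_lowerDominating, ← ENNReal.ofReal_coe_nnreal]
  exact ENNReal.ofReal_le_ofReal (abs_sum_indicator_Ioc_dyadic_le r.2 hn u)

end Algorithm

end EpsStrong

theorem mainTheorem1 {Ω : Type*} [MeasurableSpace Ω] (P : Measure Ω) [IsProbabilityMeasure P]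
    (X : ℝ → Ω → ℝ) (x y : ℝ) (hX : EpsStrong.IsBrownianBridge X x y P)
    (L U : Ω → EpsStrong.Layer)
    (hL : ∀ᵐ ω ∂P, EpsStrong.pathMin (fun t => X t ω) 0 1 ∈ (L ω).toSet)
    (hU : ∀ᵐ ω ∂P, EpsStrong.pathMax (fun t => X t ω) 0 1 ∈ (U ω).toSet) :
    ∀ᵐ ω ∂P, Tendsto
      (fun n : ℕ => ⨆ u ∈ Icc (0 : ℝ) 1,
        ENNReal.ofReal |EpsStrong.upperDominating (fun t => X t ω) (L ω) (U ω) n u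
          - EpsStrong.lowerDominating (fun t => X t ω) (L ω) (U ω) n u|)
      atTop (𝓝 0) := by
  filter_upwards [hX.continuousOn, hL, hU] with ω hω hLω hUω
  exact EpsStrong.tendsto_iSup_upperDominating_sub_lowerDominating hω hLω hUω
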